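/- Let $k$ be a nonnegative integer. Maps are continuous, and a map defined on a subset $X$ of a Euclidean space is called smooth if it has a $C^\infty$ extension to an open neighborhood of $X$. A map is proper on $X$ if its restriction to $X$ is continuous and the preimage in $X$ of every compact set is compact. Let $U\subseteq\mathbb R^k$ be open, let $f$ be an $\mathbb R^k$-valued map defined at least on $\overline U$, and let $y\in\mathbb R^k$. The triple $(f,U,y)$ is called regular if $f$ is proper on $\overline U$, $f(x)\neq y$ for all $x\in\partial U$, $f$ is smooth on $\overline U$, and the derivative $f'(x)$ is onto for every $x\in f^{-1}(y)\cap U$. For a regular triple put $$\deg(f,U,y):=\sum_{x\in f^{-1}(y)\cap U}\operatorname{sign}\bigl(\det f'(x)\bigr).$$ A smooth admissible homotopy is a triple $(H,U,\alpha)$ where $U\subseteq\mathbb R^k$ is open, $H$ is an $\mathbb R^k$-valued map defined at least on $\overline U\times[0,1]$, smooth and proper on $\overline U\times[0,1]$, $\alpha:[0,1]\to\mathbb R^k$ is a smooth path, and $H(x,\lambda)\neq\alpha(\lambda)$ for all $(x,\lambda)\in\partial U\times[0,1]$. It joins $(H(\cdot,0),U,\alpha(0))$ with $(H(\cdot,1),U,\alpha(1))$.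 Theorem. For every regular triple $(f,U,y)$ the set $f^{-1}(y)\cap U$ is finite, so that $\deg(f,U,y)$ is a well-defined integer. Moreover: (Normalization) $(I,\mathbb R^k,0)$ is a regular triple and $\deg(I,\mathbb R^k,0)=1$, where $I$ is the identity on $\mathbb R^k$. (Additivity) If $(f,U,y)$ is regular, and $U_1$ and $U_2$ are two disjoint open subsets of $U$ such that $f^{-1}(y)\cap U\subseteq U_1\cup U_2$, then $(f,U_1,y)$ and $(f,U_2,y)$ are regular and $$\deg(f,U,y)=\deg(f,U_1,y)+\deg(f,U_2,y).$$ (Homotopy Invariance) If $(H,U,\alpha)$ is a smooth admissible homotopy joining two regular triples, then $$\deg(H(\cdot,0),U,\alpha(0))=\deg(H(\cdot,1),U,\alpha(1)).$$ -/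

import Mathlib

open Set
open scoped ContDiff

noncomputable section

namespace BrouwerDegree

/-- The Euclidean space of dimension `k`. -/
abbrev Euc (k : ℕ) : Type := EuclideanSpace ℝ (Fin k)

/- A map "defined at least on `X`" is represented by a total function. Each predicate below, and the
degree, only depends on the values of the function on the relevant set (`closure U`,
`closure U ×ˢ Icc 0 1`, `Icc 0 1`, or the open set `U`). -/

/-- `f` is smooth on an arbitrary set `X`: the restriction of `f` to `X` admits a `C^∞` extension to
an open neighborhood of `X`. -/
def SmoothOn {E F : Type*} [NormedAddCommGroup E] [NormedSpace ℝ E]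
    [NormedAddCommGroup F] [NormedSpace ℝ F] (f : E → F) (X : Set E) : Prop :=
  ∃ (V : Set E) (g : E → F), IsOpen V ∧ X ⊆ V ∧ ContDiffOn ℝ ∞ g V ∧ EqOn f g X

/-- `f` is proper on `X`: its restriction to `X` is a (continuous) proper map. -/
def ProperOn {X Y : Type*} [TopologicalSpace X] [TopologicalSpace Y] (f : X → Y) (A : Set X) :
    Prop :=
  IsProperMap (A.domRestrict f)

/-- `x` is a critical point of `f`: the Fréchet derivative of `f` at `x` is not onto. -/
def IsCriticalPoint {k : ℕ} (f : Euc k → Euc k) (x : Euc k) : Prop :=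
  ¬ Function.Surjective (fderiv ℝ f x)

/-- `y` is a regular value for `f` in `U`: no point of `f⁻¹(y) ∩ U` is critical. -/
def IsRegularValueIn {k : ℕ} (f : Euc k → Euc k) (U : Set (Euc k)) (y : Euc k) : Prop :=
  ∀ x ∈ f ⁻¹' {y} ∩ U, ¬ IsCriticalPoint f x

/-- The index of `f` at `x`: the sign of the Jacobian determinant of `f` at `x`. -/
def index {k : ℕ} (f : Euc k → Euc k) (x : Euc k) : ℤ :=
  (SignType.sign (fderiv ℝ f x).det : ℤ)

/-- Admissible triples. -/
structure IsAdmissibleTriple {k : ℕ} (f : Euc k → Euc k) (U : Set (Euc k)) (y : Euc k) : Prop where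
  isOpen : IsOpen U
  properOn : ProperOn f (closure U)
  ne_of_mem_frontier : ∀ x ∈ frontier U, f x ≠ y

/-- Regular triples. -/
structure IsRegularTriple {k : ℕ} (f : Euc k → Euc k) (U : Set (Euc k)) (y : Euc k) : Prop
    extends IsAdmissibleTriple f U y where
  smoothOn : SmoothOn f (closure U)
  isRegularValueIn : IsRegularValueIn f U y

/-- The Brouwer degree of a regular triple: the sum of the indices of the points of `f⁻¹(y) ∩ U`. -/
def deg {k : ℕ} (f : Euc k → Euc k) (U : Set (Euc k)) (y : Euc k) : ℤ :=
  ∑ᶠ x ∈ f ⁻¹' {y} ∩ U, index f x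

/-- `(H, U, α)` is a homotopy of triples, joining `(H(·, 0), U, α 0)` with `(H(·, 1), U, α 1)`. -/
structure IsHomotopyOfTriples {k : ℕ} (H : Euc k × ℝ → Euc k) (U : Set (Euc k)) (α : ℝ → Euc k) :
    Prop where
  isOpen : IsOpen U
  continuousOn : ContinuousOn H (closure U ×ˢ Icc (0 : ℝ) 1)
  continuousOn_path : ContinuousOn α (Icc (0 : ℝ) 1)

/-- Admissible homotopies of triples. -/
structure IsAdmissibleHomotopy {k : ℕ} (H : Euc k × ℝ → Euc k) (U : Set (Euc k)) (α : ℝ → Euc k) :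
    Prop extends IsHomotopyOfTriples H U α where
  properOn : ProperOn H (closure U ×ˢ Icc (0 : ℝ) 1)
  ne_of_mem_frontier : ∀ x ∈ frontier U, ∀ t ∈ Icc (0 : ℝ) 1, H (x, t) ≠ α t

/-- Smoothness of a homotopy of triples: both the map and the path are smooth. -/
def IsSmoothHomotopy {k : ℕ} (H : Euc k × ℝ → Euc k) (U : Set (Euc k)) (α : ℝ → Euc k) : Prop :=
  SmoothOn H (closure U ×ˢ Icc (0 : ℝ) 1) ∧ SmoothOn α (Icc (0 : ℝ) 1)

end BrouwerDegree

end

open BrouwerDegree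

/-! The degree is an integral. If `ψ` has integral 1 and is supported close enough to `y`, then `∫_U
ψ(f x) det f'(x) dx = deg f U y`: near each preimage of `y` the map is injective with constant
index, so a change of variables contributes exactly that index, and properness keeps the rest of
`closure U` away from `y` (`IsRegularTriple.exists_setIntegral_eq_deg`).

Homotopy invariance thus reduces to constancy of such an integral along `H(x, t) - α t`, with one
bump `φ` at 0 serving both ends. The pullback of `φ dy` is closed (`fderiv_pullbackCoeff_eq_sum`),
so the time derivative of its density on a slice is a divergence in `x`. By properness this density
vanishes outside a compact subset of `U` (`IsAdmissibleHomotopy.exists_compact`), so the divergence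
integrates to 0 (`setIntegral_pullback_eq`). Intermediate times need not be regular, so no Sard
argument enters.

Finiteness holds because the fibre is compact and discrete; additivity is then the splitting of a
finite sum. -/

namespace BrouwerDegree

open MeasureTheory Filter Topology

/-! ### Determinants as multilinear maps -/

/-- The determinant of `k` vectors of `Euc k`, as an alternating map. -/
noncomputable def detAlt (k : ℕ) : Euc k [⋀^Fin k]→ₗ[ℝ] ℝ :=
  (EuclideanSpace.basisFun (Fin k) ℝ).toBasis.det

lemma detAlt_apply {k : ℕ} (c : Fin k → Euc k) :
    detAlt k c = (Matrix.of fun i j => c j i).det := by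
  simp only [detAlt, Module.Basis.det_apply]
  congr 1

/-- The determinant of `k` vectors of `Euc k`, as a continuous multilinear map. -/
noncomputable def detCM (k : ℕ) : ContinuousMultilinearMap ℝ (fun _ : Fin k => Euc k) ℝ where
  toMultilinearMap := (detAlt k).toMultilinearMap
  cont := by
    change Continuous fun c => detAlt k c
    simp only [detAlt_apply]
    refine Continuous.matrix_det (continuous_matrix fun i j => ?_)
    simp only [Matrix.of_apply]
    fun_prop

lemma detCM_apply {k : ℕ} (c : Fin k → Euc k) : detCM k c = detAlt k c := rfl

lemma det_eq_detCM {k : ℕ} (A : Euc k →L[ℝ] Euc k) :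
    A.det = detCM k (fun j => A (EuclideanSpace.single j 1)) := by
  have h := (EuclideanSpace.basisFun (Fin k) ℝ).toBasis.det_comp (A : Euc k →ₗ[ℝ] Euc k)
    (EuclideanSpace.basisFun (Fin k) ℝ).toBasis
  rw [Module.Basis.det_self, mul_one] at h
  rw [detCM_apply, detAlt, ContinuousLinearMap.det, ← h]
  congr 1
  ext j : 1
  simp

/-- Cramer's rule. -/
lemma sum_detCM_update_smul {k : ℕ} (c : Fin k → Euc k) (w : Euc k) :
    ∑ i, detCM k (Function.update c i w) • c i = detCM k c • w := by
  have h := Matrix.mulVec_cramer (Matrix.of fun i j => c j i) (fun i => w i)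
  ext l
  have hl := congrFun h l
  simp only [Matrix.mulVec, dotProduct, Matrix.of_apply, Matrix.cramer_apply, Pi.smul_apply] at hl
  simp only [detCM_apply, detAlt_apply, PiLp.smul_apply, WithLp.ofLp_sum, Finset.sum_apply,
    WithLp.ofLp_smul, smul_eq_mul, Pi.smul_apply]
  rw [← smul_eq_mul (a := Matrix.det _) (b := w l), ← hl]
  refine Finset.sum_congr rfl fun i _ => ?_
  rw [mul_comm]
  congr 2
  ext a b
  by_cases hb : b = i
  · subst hb; simp
  · simp [hb]

lemma sum_sum_eq_zero_of_antisymm {ι : Type*} [Fintype ι] (T : ι → ι → ℝ)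
    (h : ∀ i j, T i j = - T j i) : ∑ i, ∑ j, T i j = 0 := by
  have h1 : ∑ i, ∑ j, T i j = - ∑ i, ∑ j, T i j := by
    conv_lhs => rw [Finset.sum_comm]
    simp only [← Finset.sum_neg_distrib]
    exact Finset.sum_congr rfl fun i _ => Finset.sum_congr rfl fun j _ => h _ _
  linarith

lemma detCM_update_update_antisymm {k : ℕ} (c : Fin k → Euc k) (w s : Euc k) {i j : Fin k}
    (hij : i ≠ j) :
    detCM k (Function.update (Function.update c i w) j s) =
      - detCM k (Function.update (Function.update c j w) i s) := by
  have h := (detAlt k).map_swap (Function.update (Function.update c j w) i s) hij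
  rw [detCM_apply, detCM_apply, ← h]
  congr 1
  ext l : 1
  rcases eq_or_ne l i with rfl | hi
  · simp [hij, hij.symm]
  rcases eq_or_ne l j with rfl | hj
  · simp
  · simp [Equiv.swap_apply_of_ne_of_ne hi hj, hi, hj]

/-! ### Closedness of the pulled-back volume form -/

section Pullback

variable {P : Type*} [NormedAddCommGroup P] [NormedSpace ℝ P]

/-- The coefficient of the pullback of the form `φ dy` under `G`, evaluated on the vectors `u`. -/
noncomputable def pullbackCoeff {k : ℕ} (φ : Euc k → ℝ) (G : P → Euc k) (u : Fin k → P) (q : P) :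
    ℝ :=
  φ (G q) * detCM k (fun j => fderiv ℝ G q (u j))

lemma fderiv_pullbackCoeff {k : ℕ} {φ : Euc k → ℝ} {G : P → Euc k} {p : P}
    (hφ : DifferentiableAt ℝ φ (G p)) (hG : ContDiffAt ℝ 2 G p) (u : Fin k → P) (ξ : P) :
    fderiv ℝ (pullbackCoeff φ G u) p ξ =
      φ (G p) * ∑ j, detCM k (Function.update (fun l => fderiv ℝ G p (u l)) j
        (fderiv ℝ (fderiv ℝ G) p ξ (u j))) +
      detCM k (fun j => fderiv ℝ G p (u j)) * fderiv ℝ φ (G p) (fderiv ℝ G p ξ) := by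
  have hG1 : HasFDerivAt G (fderiv ℝ G p) p := (hG.differentiableAt two_ne_zero).hasFDerivAt
  have hG2 : HasFDerivAt (fderiv ℝ G) (fderiv ℝ (fderiv ℝ G) p) p :=
    ((hG.fderiv_right (m := 1) (by norm_num)).differentiableAt one_ne_zero).hasFDerivAt
  have h1 : HasFDerivAt (fun q => φ (G q)) ((fderiv ℝ φ (G p)).comp (fderiv ℝ G p)) p :=
    hφ.hasFDerivAt.comp p hG1
  have h2 := HasFDerivAt.multilinear_comp (detCM k)
    (g := fun j q => fderiv ℝ G q (u j)) (x := p)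
    (fun j => hG2.clm_apply (hasFDerivAt_const (u j) p))
  have h3 := (h1.mul h2).fderiv
  change fderiv ℝ (pullbackCoeff φ G u) p = _ at h3
  rw [h3]
  simp

/-- The pullback of a top-degree form is closed. -/
lemma fderiv_pullbackCoeff_eq_sum {k : ℕ} {φ : Euc k → ℝ} {G : P → Euc k} {p : P}
    (hφ : DifferentiableAt ℝ φ (G p)) (hG : ContDiffAt ℝ 2 G p) (v : Fin k → P) (τ : P) :
    fderiv ℝ (pullbackCoeff φ G v) p τ =
      ∑ i, fderiv ℝ (pullbackCoeff φ G (Function.update v i τ)) p (v i) := by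
  have hS : IsSymmSndFDerivAt ℝ G p := hG.isSymmSndFDerivAt (by simp)
  simp only [fderiv_pullbackCoeff hφ hG, Finset.sum_add_distrib, ← Finset.mul_sum]
  have hup : ∀ i, (fun l => fderiv ℝ G p (Function.update v i τ l)) =
      Function.update (fun l => fderiv ℝ G p (v l)) i (fderiv ℝ G p τ) := fun i => by
    ext l : 1
    exact Function.apply_update (fun _ x => fderiv ℝ G p x) v i τ l
  simp only [hup]
  generalize hc : (fun l => fderiv ℝ G p (v l)) = c
  congr 1
  · congr 1
    -- The second-derivative terms with `j ≠ i`. Exchanging `i` and `j` swaps two columns and leaves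
    -- the symmetric second derivative unchanged, so they cancel in pairs; only `j = i` survives.
    let T : Fin k → Fin k → ℝ := fun i j => if i = j then 0 else
      detCM k (Function.update (Function.update c i (fderiv ℝ G p τ)) j
        (fderiv ℝ (fderiv ℝ G) p (v i) (v j)))
    have hT : ∑ i, ∑ j, T i j = 0 := sum_sum_eq_zero_of_antisymm T fun i j => by
      by_cases hij : i = j
      · simp [T, hij]
      · simp only [T, hij, Ne.symm hij, if_false]
        rw [detCM_update_update_antisymm _ _ _ hij, hS.eq (v i) (v j)]
    rw [← add_zero (∑ j, _), ← hT, ← Finset.sum_add_distrib]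
    refine Finset.sum_congr rfl fun i _ => ?_
    rw [← Finset.add_sum_erase _ (T i) (Finset.mem_univ i),
      ← Finset.add_sum_erase _ _ (Finset.mem_univ i)]
    simp only [Function.update_self, Function.update_idem, T, if_true, zero_add]
    rw [hS.eq τ (v i)]
    congr 1
    refine Finset.sum_congr rfl fun j hj => ?_
    have hji := Finset.ne_of_mem_erase hj
    simp [hji, hji.symm]
  -- The terms containing the derivative of `φ` agree by Cramer's rule for the columns `c`, to which
  -- that derivative is applied.
  · have h := sum_detCM_update_smul c (fderiv ℝ G p τ)
    have h' := congrArg (fderiv ℝ φ (G p)) h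
    simp only [map_sum, map_smul, smul_eq_mul] at h'
    rw [← h', ← hc]

end Pullback

/-! ### Extension by zero and integrals over time slices -/

lemma contDiff_indicator_of_eq_zero {P F : Type*} [NormedAddCommGroup P] [NormedSpace ℝ P]
    [NormedAddCommGroup F] [NormedSpace ℝ F] {n : ℕ∞ω} {A : P → F} {U C : Set P}
    (hU : IsOpen U) (hC : IsClosed C) (hCU : C ⊆ U) (hA : ContDiffOn ℝ n A U)
    (h0 : ∀ x ∈ U \ C, A x = 0) : ContDiff ℝ n (U.indicator A) := by
  rw [contDiff_iff_contDiffAt]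
  intro x
  by_cases hx : x ∈ U
  · refine (hA.contDiffAt (hU.mem_nhds hx)).congr_of_eventuallyEq ?_
    filter_upwards [hU.mem_nhds hx] with y hy using indicator_of_mem hy _
  -- A point outside `U` has a neighbourhood missing the closed set `C`, on which the extension is
  -- identically 0.
  · refine (contDiffAt_const (c := (0 : F))).congr_of_eventuallyEq ?_
    filter_upwards [hC.isOpen_compl.mem_nhds fun h => hx (hCU h)] with y hy
    by_cases hyU : y ∈ U
    · rw [indicator_of_mem hyU, h0 y ⟨hyU, hy⟩]
    · exact indicator_of_notMem hyU _

lemma integrable_slice {E : Type*} [NormedAddCommGroup E] [MeasurableSpace E] [BorelSpace E]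
    (μ : Measure E) [IsFiniteMeasureOnCompacts μ] {C : Set E} (hC : IsCompact C) {h : E × ℝ → ℝ} (hh : Continuous h)
    (h0 : ∀ p : E × ℝ, p.1 ∉ C → h p = 0) (t : ℝ) : Integrable (fun x => h (x, t)) μ :=
  (hh.comp (by fun_prop)).integrable_of_hasCompactSupport
    (HasCompactSupport.intro hC fun x hx => h0 (x, t) hx)

section Slices

variable {E : Type*} [NormedAddCommGroup E] [NormedSpace ℝ E] {g : E × ℝ → ℝ} {C : Set E}

lemma fderiv_eq_zero_of_fst_notMem (hC : IsClosed C) (h0 : ∀ p : E × ℝ, p.1 ∉ C → g p = 0)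
    {p : E × ℝ} (hp : p.1 ∉ C) : fderiv ℝ g p = 0 := by
  have : g =ᶠ[𝓝 p] fun _ => 0 := by
    filter_upwards [(hC.isOpen_compl.preimage continuous_fst).mem_nhds hp] with q hq using h0 q hq
  rw [this.fderiv_eq]
  simp

variable [MeasurableSpace E] [BorelSpace E] [FiniteDimensional ℝ E] (μ : Measure E)
  [μ.IsAddHaarMeasure]

lemma integral_fderiv_slice_eq_zero (hC : IsCompact C) (hg : ContDiff ℝ 1 g)
    (h0 : ∀ p : E × ℝ, p.1 ∉ C → g p = 0) (t : ℝ) (e : E) :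
    ∫ x, fderiv ℝ g (x, t) (e, 0) ∂μ = 0 := by
  have hd : ∀ x, HasFDerivAt (fun x => g (x, t))
      ((fderiv ℝ g (x, t)).comp (ContinuousLinearMap.inl ℝ E ℝ)) x := fun x => by
    have h1 := ((hg.differentiable one_ne_zero) (x, t)).hasFDerivAt
    exact h1.comp x (hasFDerivAt_prodMk_left x t)
  have hd' : ∀ x, fderiv ℝ (fun x => g (x, t)) x e = fderiv ℝ g (x, t) (e, 0) := fun x => by
    rw [(hd x).fderiv]; simp
  have hint : Integrable (fun x => fderiv ℝ g (x, t) (e, 0)) μ :=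
    integrable_slice μ hC (h := fun p => fderiv ℝ g p (e, 0))
      ((hg.continuous_fderiv one_ne_zero).clm_apply continuous_const)
      (fun p hp => by simp [fderiv_eq_zero_of_fst_notMem hC.isClosed h0 hp]) t
  -- Integration by parts against the constant function 1.
  have h := integral_mul_fderiv_eq_neg_fderiv_mul_of_integrable (𝕜 := ℝ) (μ := μ)
    (f := fun _ => (1 : ℝ)) (g := fun x => g (x, t)) (v := e) (by simp)
    (by simpa only [hd', one_mul] using hint)
    (by simpa using integrable_slice μ hC hg.continuous h0 t)
    (fun _ _ => differentiableAt_const _) (fun x _ => (hd x).differentiableAt)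
  simpa [hd'] using h

/-- Fubini and the fundamental theorem of calculus in `t`; the support over the compact `C` supplies
integrability. -/
lemma integral_slice_sub (hC : IsCompact C) (hg : ContDiff ℝ 1 g)
    (h0 : ∀ p : E × ℝ, p.1 ∉ C → g p = 0) :
    ∫ x, g (x, 1) ∂μ - ∫ x, g (x, 0) ∂μ =
      ∫ t in (0 : ℝ)..1, ∫ x, fderiv ℝ g (x, t) (0, 1) ∂μ := by
  have hcont : Continuous fun p => fderiv ℝ g p (0, 1) :=
    (hg.continuous_fderiv one_ne_zero).clm_apply continuous_const
  have hz : ∀ p : E × ℝ, p.1 ∉ C → fderiv ℝ g p (0, 1) = 0 := fun p hp => by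
    simp [fderiv_eq_zero_of_fst_notMem hC.isClosed h0 hp]
  have hint : Integrable (Function.uncurry fun (t : ℝ) (x : E) => fderiv ℝ g (x, t) (0, 1))
      ((volume.restrict (uIoc 0 1)).prod μ) := by
    have hc : Continuous (Function.uncurry fun (t : ℝ) (x : E) => fderiv ℝ g (x, t) (0, 1)) :=
      hcont.comp continuous_swap
    have h1 : IntegrableOn (Function.uncurry fun (t : ℝ) (x : E) => fderiv ℝ g (x, t) (0, 1))
        (Icc 0 1 ×ˢ C) (volume.prod μ) :=
      hc.continuousOn.integrableOn_compact (isCompact_Icc.prod hC)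
    have h2 : IntegrableOn (Function.uncurry fun (t : ℝ) (x : E) => fderiv ℝ g (x, t) (0, 1))
        (Icc 0 1 ×ˢ univ) (volume.prod μ) := by
      refine h1.of_forall_sdiff_eq_zero (measurableSet_Icc.prod MeasurableSet.univ) ?_
      rintro ⟨t, x⟩ ⟨⟨ht, -⟩, hn⟩
      exact hz (x, t) fun hx => hn ⟨ht, hx⟩
    have h3 : (volume.restrict (uIoc (0 : ℝ) 1)).prod μ =
        (volume.prod μ).restrict (uIoc 0 1 ×ˢ univ) := by
      rw [← Measure.prod_restrict, Measure.restrict_univ]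
    rw [h3]
    refine h2.mono_set (prod_mono_left ?_)
    rw [uIoc_of_le zero_le_one]
    exact Ioc_subset_Icc_self
  rw [intervalIntegral_integral_swap hint, ← integral_sub (integrable_slice μ hC hg.continuous h0 1)
    (integrable_slice μ hC hg.continuous h0 0)]
  refine integral_congr_ae (Eventually.of_forall fun x => ?_)
  refine (intervalIntegral.integral_eq_sub_of_hasDerivAt (f := fun t => g (x, t)) (fun t _ => ?_)
    ?_).symm
  · have h1 := ((hg.differentiable one_ne_zero) (x, t)).hasFDerivAt
    have h2 : HasDerivAt (fun s : ℝ => (x, s)) ((0 : E), (1 : ℝ)) t :=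
      (hasDerivAt_const t x).prodMk (hasDerivAt_id t)
    exact h1.comp_hasDerivAt t h2
  · exact (hcont.comp (by fun_prop : Continuous fun t : ℝ => (x, t))).intervalIntegrable _ _

end Slices

/-! ### Stokes' theorem for the pulled-back form -/

lemma contDiffOn_pullbackCoeff {P : Type*} [NormedAddCommGroup P] [NormedSpace ℝ P] {k : ℕ}
    {φ : Euc k → ℝ} {G : P → Euc k} {V : Set P} (hV : IsOpen V) (hφ : ContDiff ℝ ∞ φ)
    (hG : ContDiffOn ℝ ∞ G V) (u : Fin k → P) : ContDiffOn ℝ 1 (pullbackCoeff φ G u) V := by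
  have h1 : ContDiffOn ℝ 1 (fderiv ℝ G) V :=
    (hG.of_le (m := 2) ENat.LEInfty.out).fderiv_of_isOpen hV (by norm_num)
  refine ((hφ.of_le (by simp)).comp_contDiffOn (hG.of_le (by simp))).mul ?_
  exact (detCM k).contDiff.comp_contDiffOn
    (contDiffOn_pi.2 fun j => h1.clm_apply contDiffOn_const)

/-- The integral of the pullback of `φ dy` under a compactly controlled homotopy is constant. -/
theorem setIntegral_pullback_eq {k : ℕ} {φ : Euc k → ℝ} {G : Euc k × ℝ → Euc k} {U C : Set (Euc k)}
    (hU : IsOpen U) (hC : IsCompact C) (hCU : C ⊆ U) (hφ : ContDiff ℝ ∞ φ)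
    (hG : ContDiffOn ℝ ∞ G (U ×ˢ univ)) (h0 : ∀ x ∈ U \ C, ∀ t, φ (G (x, t)) = 0) :
    ∫ x in U, φ (G (x, 0)) * (fderiv ℝ (fun x => G (x, 0)) x).det =
      ∫ x in U, φ (G (x, 1)) * (fderiv ℝ (fun x => G (x, 1)) x).det := by
  set V : Set (Euc k × ℝ) := U ×ˢ univ
  have hV : IsOpen V := hU.prod isOpen_univ
  let v : Fin k → Euc k × ℝ := fun j => (EuclideanSpace.single j 1, 0)
  let F : (Fin k → Euc k × ℝ) → Euc k × ℝ → ℝ := fun u => V.indicator (pullbackCoeff φ G u)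
  have hF : ∀ u, ContDiff ℝ 1 (F u) := fun u =>
    contDiff_indicator_of_eq_zero hV (hC.isClosed.prod isClosed_univ) (prod_mono_left hCU)
      (contDiffOn_pullbackCoeff hV hφ hG u) (by
        rintro ⟨x, t⟩ ⟨⟨hx, -⟩, hn⟩
        simp [pullbackCoeff, h0 x ⟨hx, fun h => hn ⟨h, mem_univ _⟩⟩ t])
  have hF0 : ∀ u (p : Euc k × ℝ), p.1 ∉ C → F u p = 0 := by
    rintro u ⟨x, t⟩ hn
    by_cases hx : x ∈ U
    · simp [F, V, hx, pullbackCoeff, h0 x ⟨hx, hn⟩ t]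
    · simp [F, V, hx]
  -- Closedness in divergence form: the time derivative of the slice density is a sum of spatial
  -- derivatives of compactly supported coefficients.
  have hdiv : ∀ p, fderiv ℝ (F v) p (0, 1) =
      ∑ i, fderiv ℝ (F (Function.update v i (0, 1))) p (v i) := by
    intro p
    by_cases hp : p.1 ∈ U
    · have hpV : V ∈ 𝓝 p := hV.mem_nhds ⟨hp, mem_univ _⟩
      have he : ∀ u, fderiv ℝ (F u) p = fderiv ℝ (pullbackCoeff φ G u) p := fun u => by
        apply Filter.EventuallyEq.fderiv_eq
        filter_upwards [hpV] with q hq using indicator_of_mem hq _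
      simp only [he]
      exact fderiv_pullbackCoeff_eq_sum ((hφ.differentiable (by simp)) _)
        ((hG.contDiffAt hpV).of_le ENat.LEInfty.out) v (0, 1)
    · have hpC : p.1 ∉ C := fun h => hp (hCU h)
      simp [fderiv_eq_zero_of_fst_notMem hC.isClosed (hF0 _) hpC]
  have hslice : ∀ t, ∫ x in U, φ (G (x, t)) * (fderiv ℝ (fun x => G (x, t)) x).det =
      ∫ x, F v (x, t) := by
    intro t
    rw [← integral_indicator hU.measurableSet]
    refine integral_congr_ae (Eventually.of_forall fun x => ?_)
    by_cases hx : x ∈ U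
    · have hxV : (x, t) ∈ V := ⟨hx, mem_univ _⟩
      have hd : HasFDerivAt (fun x => G (x, t))
          ((fderiv ℝ G (x, t)).comp (ContinuousLinearMap.inl ℝ (Euc k) ℝ)) x :=
        ((hG.contDiffAt (hV.mem_nhds hxV)).differentiableAt (by simp)).hasFDerivAt.comp x
          (hasFDerivAt_prodMk_left x t)
      simp only [F, indicator_of_mem hx, indicator_of_mem hxV, pullbackCoeff, v]
      rw [hd.fderiv, det_eq_detCM]
      simp
    · simp [F, V, hx]
  rw [hslice, hslice, eq_comm, ← sub_eq_zero,
    integral_slice_sub volume hC (hF v) (hF0 v)]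
  have hzero : ∀ t : ℝ, ∫ x, fderiv ℝ (F v) (x, t) (0, 1) = 0 := by
    intro t
    simp only [hdiv]
    rw [integral_finsetSum]
    · exact Finset.sum_eq_zero fun i _ => integral_fderiv_slice_eq_zero volume hC (hF _) (hF0 _) t _
    · intro i _
      exact integrable_slice volume hC
        (h := fun p => fderiv ℝ (F (Function.update v i (0, 1))) p (v i))
        (((hF _).continuous_fderiv one_ne_zero).clm_apply continuous_const)
        (fun p hp => by simp [fderiv_eq_zero_of_fst_notMem hC.isClosed (hF0 _) hp]) t
  simp [hzero]

/-! ### Smoothness and properness on subsets -/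

lemma SmoothOn.mono {E F : Type*} [NormedAddCommGroup E] [NormedSpace ℝ E]
    [NormedAddCommGroup F] [NormedSpace ℝ F] {f : E → F} {X Y : Set E} (h : SmoothOn f X)
    (hYX : Y ⊆ X) : SmoothOn f Y := by
  obtain ⟨V, g, hV, hXV, hg, hfg⟩ := h
  exact ⟨V, g, hV, hYX.trans hXV, hg, hfg.mono hYX⟩

lemma SmoothOn.contDiffOn {E F : Type*} [NormedAddCommGroup E] [NormedSpace ℝ E]
    [NormedAddCommGroup F] [NormedSpace ℝ F] {f : E → F} {X : Set E} (h : SmoothOn f X) :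
    ContDiffOn ℝ ∞ f X := by
  obtain ⟨V, g, -, hXV, hg, hfg⟩ := h
  exact (hg.mono hXV).congr hfg

lemma ProperOn.isCompact_inter_preimage {X Y : Type*} [TopologicalSpace X] [TopologicalSpace Y]
    {f : X → Y} {A : Set X} (h : ProperOn f A) {K : Set Y} (hK : IsCompact K) :
    IsCompact (A ∩ f ⁻¹' K) := by
  have h1 := (IsProperMap.isCompact_preimage h hK).image continuous_subtype_val
  convert h1 using 1
  ext x
  simp [domRestrict_apply, and_comm]

lemma ProperOn.mono {X Y : Type*} [TopologicalSpace X] [TopologicalSpace Y]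
    {f : X → Y} {A B : Set X} (h : ProperOn f A) (hB : IsClosed B) (hBA : B ⊆ A) :
    ProperOn f B := by
  have hi : IsClosedEmbedding (inclusion hBA) :=
    ⟨IsEmbedding.inclusion hBA, by
      rw [range_inclusion]
      exact hB.preimage continuous_subtype_val⟩
  exact IsProperMap.comp (g := A.domRestrict f) h hi.isProperMap

lemma ProperOn.isClosed_image {X Y : Type*} [TopologicalSpace X] [TopologicalSpace Y]
    {f : X → Y} {A B : Set X} (h : ProperOn f A) (hB : IsClosed B) (hBA : B ⊆ A) :
    IsClosed (f '' B) := by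
  have h1 := IsProperMap.isClosed_range (h.mono hB hBA)
  rwa [range_domRestrict] at h1

/-! ### Local structure and finiteness of a regular fibre -/

variable {k : ℕ} {f : Euc k → Euc k} {U : Set (Euc k)} {y : Euc k}

lemma IsRegularTriple.contDiffOn (h : IsRegularTriple f U y) : ContDiffOn ℝ ∞ f U :=
  h.smoothOn.contDiffOn.mono subset_closure

lemma IsRegularTriple.det_ne_zero (h : IsRegularTriple f U y) {x : Euc k}
    (hx : x ∈ f ⁻¹' {y} ∩ U) : (fderiv ℝ f x).det ≠ 0 := by
  have hs : Function.Surjective (fderiv ℝ f x) := not_not.1 (h.isRegularValueIn x hx)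
  have hu : IsUnit (fderiv ℝ f x : Euc k →ₗ[ℝ] Euc k) :=
    (LinearMap.isUnit_iff_range_eq_top _).2 (LinearMap.range_eq_top.2 hs)
  exact ((LinearMap.isUnit_iff_isUnit_det _).1 hu).ne_zero

lemma index_mul_abs_det (x : Euc k) :
    (index f x : ℝ) * |(fderiv ℝ f x).det| = (fderiv ℝ f x).det := by
  have : (index f x : ℝ) = (SignType.sign (fderiv ℝ f x).det : ℝ) := by simp [index]
  rw [this, sign_mul_abs]

/-- Near a point where the Jacobian does not vanish, a smooth map is injective and open, and its
index is constant. -/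
lemma exists_isOpen_injOn_index_eq (hU : IsOpen U) (hf : ContDiffOn ℝ ∞ f U) {z : Euc k}
    (hz : z ∈ U) (hdet : (fderiv ℝ f z).det ≠ 0) {W : Set (Euc k)} (hW : IsOpen W) (hzW : z ∈ W) :
    ∃ N, IsOpen N ∧ z ∈ N ∧ N ⊆ W ∧ N ⊆ U ∧ InjOn f N ∧ f '' N ∈ 𝓝 (f z) ∧
      ∀ x ∈ N, index f x = index f z := by
  have hfz : ContDiffAt ℝ ∞ f z := hf.contDiffAt (hU.mem_nhds hz)
  have hs : HasStrictFDerivAt f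
      ((fderiv ℝ f z).toContinuousLinearEquivOfDetNeZero hdet : Euc k →L[ℝ] Euc k) z := by
    rw [ContinuousLinearMap.coe_toContinuousLinearEquivOfDetNeZero]
    exact hfz.hasStrictFDerivAt (by simp)
  have hc : ContinuousAt (fun x => SignType.sign (fderiv ℝ f x).det) z :=
    ContinuousAt.comp (f := fun x => (fderiv ℝ f x).det) (continuousAt_sign_of_ne_zero hdet)
      (ContinuousAt.comp (f := fderiv ℝ f) (g := ContinuousLinearMap.det)
        ContinuousLinearMap.continuous_det.continuousAt
        (hfz.fderiv_right (m := 0) (by simp)).continuousAt)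
  have hS : {x | SignType.sign (fderiv ℝ f x).det = SignType.sign (fderiv ℝ f z).det} ∈ 𝓝 z :=
    hc.preimage_mem_nhds ((isOpen_discrete {SignType.sign (fderiv ℝ f z).det}).mem_nhds rfl)
  let e := hs.toOpenPartialHomeomorph f
  have he : e.source ∈ 𝓝 z := e.open_source.mem_nhds hs.mem_toOpenPartialHomeomorph_source
  have hM := inter_mem (inter_mem he hS) (inter_mem (hW.mem_nhds hzW) (hU.mem_nhds hz))
  refine ⟨interior _, isOpen_interior, mem_interior_iff_mem_nhds.2 hM,
    fun x hx => (interior_subset hx).2.1, fun x hx => (interior_subset hx).2.2,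
    e.injOn.mono fun x hx => (interior_subset hx).1.1, ?_, fun x hx => ?_⟩
  · rw [← hs.map_nhds_eq_of_equiv]
    exact image_mem_map (interior_mem_nhds.2 hM)
  · have := (interior_subset hx).1.2
    simp only [mem_ofPred_eq] at this
    simp [index, this]

lemma IsRegularTriple.finite (h : IsRegularTriple f U y) : (f ⁻¹' {y} ∩ U).Finite := by
  -- Nothing on the frontier maps to `y`, so the fibre in `U` equals the fibre in `closure U`, which
  -- properness makes compact.
  have hcl : closure U ∩ f ⁻¹' {y} = f ⁻¹' {y} ∩ U := by
    ext x
    refine ⟨fun ⟨hx, hxy⟩ => ⟨hxy, ?_⟩, fun ⟨hxy, hx⟩ => ⟨subset_closure hx, hxy⟩⟩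
    by_contra hxU
    exact h.ne_of_mem_frontier x ⟨hx, by rwa [h.isOpen.interior_eq]⟩ hxy
  have hc := h.properOn.isCompact_inter_preimage (isCompact_singleton (x := y))
  rw [hcl] at hc
  refine hc.finite (isDiscrete_iff_forall_mem_exists_isOpen.2 fun z hz => ?_)
  obtain ⟨N, hN, hzN, -, -, hinj, -, -⟩ := exists_isOpen_injOn_index_eq h.isOpen h.contDiffOn hz.2
    (h.det_ne_zero hz) isOpen_univ (mem_univ z)
  refine ⟨N, hN, ?_⟩
  ext x
  simp only [mem_inter_iff, mem_singleton_iff]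
  constructor
  · rintro ⟨hxN, hxy, -⟩
    exact hinj hxN hzN (hxy.trans hz.1.symm)
  · rintro rfl
    exact ⟨hzN, hz⟩

/-! ### The degree as an integral -/

lemma setIntegral_pullback_of_injOn {N : Set (Euc k)} (hN : IsOpen N)
    (hf : DifferentiableOn ℝ f N) (hinj : InjOn f N) {d : ℤ} (hd : ∀ x ∈ N, index f x = d)
    {ψ : Euc k → ℝ} (hψ : Integrable ψ) (hsupp : Function.support ψ ⊆ f '' N) :
    IntegrableOn (fun x => ψ (f x) * (fderiv ℝ f x).det) N ∧
      ∫ x in N, ψ (f x) * (fderiv ℝ f x).det = d * ∫ w, ψ w := by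
  have hf' : ∀ x ∈ N, HasFDerivWithinAt f (fderiv ℝ f x) N x := fun x hx =>
    ((hf.differentiableAt (hN.mem_nhds hx)).hasFDerivAt).hasFDerivWithinAt
  -- The constant index `d` turns the `|det|` of the change of variables formula into the signed
  -- determinant.
  have heq : ∀ x ∈ N, (d : ℝ) * (|(fderiv ℝ f x).det| • ψ (f x)) =
      ψ (f x) * (fderiv ℝ f x).det := fun x hx => by
    rw [smul_eq_mul, ← mul_assoc, ← hd x hx, index_mul_abs_det, mul_comm]
  have hint := (integrableOn_image_iff_integrableOn_abs_det_fderiv_smul volume hN.measurableSet hf'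
    hinj ψ).1 hψ.integrableOn
  refine ⟨IntegrableOn.congr_fun (hint.const_mul (d : ℝ)) heq hN.measurableSet, ?_⟩
  rw [← setIntegral_congr_fun hN.measurableSet heq, integral_const_mul,
    ← integral_image_eq_integral_abs_det_fderiv_smul volume hN.measurableSet hf' hinj ψ,
    setIntegral_eq_integral_of_forall_compl_eq_zero fun x hx =>
      Function.notMem_support.1 fun hx' => hx (hsupp hx')]

/-- The degree is the integral of the pullback of any normalized density concentrated near `y`. -/
theorem IsRegularTriple.exists_setIntegral_eq_deg (h : IsRegularTriple f U y) :
    ∃ ε > 0, ∀ ψ : Euc k → ℝ, Integrable ψ → Function.support ψ ⊆ Metric.ball y ε →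
      ∫ w, ψ w = 1 → ∫ x in U, ψ (f x) * (fderiv ℝ f x).det = deg f U y := by
  have hfin := h.finite
  obtain ⟨W, hW, hdisj⟩ := hfin.t2_separation
  have hloc : ∀ z : Euc k, ∃ N, z ∈ f ⁻¹' {y} ∩ U → IsOpen N ∧ z ∈ N ∧ N ⊆ W z ∧ N ⊆ U ∧
      InjOn f N ∧ f '' N ∈ 𝓝 (f z) ∧ ∀ x ∈ N, index f x = index f z := fun z => by
    by_cases hz : z ∈ f ⁻¹' {y} ∩ U
    · obtain ⟨N, hN⟩ := exists_isOpen_injOn_index_eq h.isOpen h.contDiffOn hz.2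
        (h.det_ne_zero hz) (hW z).2 (hW z).1
      exact ⟨N, fun _ => hN⟩
    · exact ⟨∅, fun h => absurd h hz⟩
  choose N hN using hloc
  set s := hfin.toFinset with hs
  have hmem : ∀ z ∈ s, z ∈ f ⁻¹' {y} ∩ U := fun z hz => hfin.mem_toFinset.1 hz
  set M := ⋃ z ∈ s, N z with hMdef
  have hMo : IsOpen M := isOpen_biUnion fun z hz => (hN z (hmem z hz)).1
  have hMU : M ⊆ U := iUnion₂_subset fun z hz => (hN z (hmem z hz)).2.2.2.1
  have hcl : IsClosed (f '' (closure U \ M)) :=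
    h.properOn.isClosed_image (isClosed_closure.sdiff hMo) sdiff_subset
  -- Proper maps are closed, so a whole ball around `y` is missed outside the chosen neighbourhoods
  -- of its preimages.
  have hy : (f '' (closure U \ M))ᶜ ∈ 𝓝 y := by
    refine hcl.isOpen_compl.mem_nhds ?_
    rintro ⟨x, ⟨hx, hxM⟩, hxy⟩
    by_cases hxU : x ∈ U
    · have hxs : x ∈ s := hfin.mem_toFinset.2 ⟨hxy, hxU⟩
      exact hxM (mem_biUnion hxs (hN x (hmem x hxs)).2.1)
    · exact h.ne_of_mem_frontier x ⟨hx, by rwa [h.isOpen.interior_eq]⟩ hxy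
  have himg : ∀ z ∈ s, f '' N z ∈ 𝓝 y := fun z hz => by
    have h1 := (hN z (hmem z hz)).2.2.2.2.2.1
    rwa [show f z = y from (hmem z hz).1] at h1
  obtain ⟨ε, hε, hball⟩ := Metric.mem_nhds_iff.1
    (inter_mem hy ((Finset.iInter_mem_sets s).2 himg))
  refine ⟨ε, hε, fun ψ hψ hsupp hψ1 => ?_⟩
  have hpiece : ∀ z ∈ s, _ := fun z hz =>
    setIntegral_pullback_of_injOn (hN z (hmem z hz)).1
      ((h.contDiffOn.differentiableOn (by simp)).mono (hN z (hmem z hz)).2.2.2.1)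
      (hN z (hmem z hz)).2.2.2.2.1 (hN z (hmem z hz)).2.2.2.2.2.2 hψ
      (hsupp.trans fun w hw => mem_iInter₂.1 (hball hw).2 z hz)
  rw [setIntegral_eq_of_subset_of_forall_sdiff_eq_zero h.isOpen.measurableSet hMU ?_, hMdef,
    integral_biUnion_finset s (fun z hz => (hN z (hmem z hz)).1.measurableSet) ?_
      (fun z hz => (hpiece z hz).1),
    Finset.sum_congr rfl (fun z hz => (hpiece z hz).2), deg,
    finsum_mem_eq_finite_toFinset_sum _ hfin]
  · simp [hψ1, hs]
  · intro z hz z' hz' hne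
    exact (hdisj (hmem z hz) (hmem z' hz') hne).mono (hN z (hmem z hz)).2.2.1
      (hN z' (hmem z' hz')).2.2.1
  · rintro x ⟨hxU, hxM⟩
    have : ψ (f x) = 0 := Function.notMem_support.1 fun hx =>
      (hball (hsupp hx)).1 ⟨x, ⟨subset_closure hxU, hxM⟩, rfl⟩
    rw [this, zero_mul]

/-! ### Normalization and additivity -/

lemma isRegularTriple_id : IsRegularTriple (id : Euc k → Euc k) univ 0 where
  isOpen := isOpen_univ
  properOn := by
    rw [closure_univ]
    exact isClosed_univ.isProperMap_subtypeVal
  ne_of_mem_frontier := by simp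
  smoothOn := ⟨univ, id, isOpen_univ, subset_univ _, contDiff_id.contDiffOn, fun _ _ => rfl⟩
  isRegularValueIn := by
    rintro x -
    simp only [IsCriticalPoint, not_not, fderiv_id]
    exact Function.surjective_id

lemma deg_id : deg (id : Euc k → Euc k) univ 0 = 1 := by
  have h : (id ⁻¹' {0} ∩ univ : Set (Euc k)) = {0} := by simp
  rw [deg, h, finsum_mem_singleton]
  simp [index, ContinuousLinearMap.det]

lemma IsRegularTriple.of_subset {f : Euc k → Euc k} {U U₁ U₂ : Set (Euc k)} {y : Euc k}
    (h : IsRegularTriple f U y) (hU₁ : IsOpen U₁) (hU₂ : IsOpen U₂) (h₁ : U₁ ⊆ U)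
    (hd : Disjoint U₁ U₂) (hsub : f ⁻¹' {y} ∩ U ⊆ U₁ ∪ U₂) : IsRegularTriple f U₁ y where
  isOpen := hU₁
  properOn := h.properOn.mono isClosed_closure (closure_mono h₁)
  ne_of_mem_frontier := by
    rintro x ⟨hx, hx'⟩ hxy
    rw [hU₁.interior_eq] at hx'
    by_cases hxU : x ∈ U
    · rcases hsub ⟨hxy, hxU⟩ with hx1 | hx2
      · exact hx' hx1
      -- An open set disjoint from `U₁` is disjoint from its closure.
      · exact (hd.closure_left hU₂).le_bot ⟨hx, hx2⟩
    · exact h.ne_of_mem_frontier x ⟨closure_mono h₁ hx, by rwa [h.isOpen.interior_eq]⟩ hxy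
  smoothOn := h.smoothOn.mono (closure_mono h₁)
  isRegularValueIn := fun x hx => h.isRegularValueIn x ⟨hx.1, h₁ hx.2⟩

lemma deg_eq_add {f : Euc k → Euc k} {U U₁ U₂ : Set (Euc k)} {y : Euc k}
    (h : IsRegularTriple f U y) (h₁ : U₁ ⊆ U) (h₂ : U₂ ⊆ U)
    (hd : Disjoint U₁ U₂) (hsub : f ⁻¹' {y} ∩ U ⊆ U₁ ∪ U₂) :
    deg f U y = deg f U₁ y + deg f U₂ y := by
  have hfin := h.finite
  have hunion : f ⁻¹' {y} ∩ U = (f ⁻¹' {y} ∩ U₁) ∪ (f ⁻¹' {y} ∩ U₂) := by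
    rw [← inter_union_distrib_left]
    exact Subset.antisymm (fun x hx => ⟨hx.1, hsub hx⟩)
      (inter_subset_inter_right _ (union_subset h₁ h₂))
  rw [deg, hunion, finsum_mem_union (hd.mono inter_subset_right inter_subset_right)
    (hfin.subset (inter_subset_inter_right _ h₁)) (hfin.subset (inter_subset_inter_right _ h₂))]
  rfl

/-! ### Homotopy invariance of the degree -/

/-- An admissible homotopy keeps its values away from the path outside a compact subset of `U`. -/
lemma IsAdmissibleHomotopy.exists_compact {H : Euc k × ℝ → Euc k} {U : Set (Euc k)} {α : ℝ → Euc k}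
    (h : IsAdmissibleHomotopy H U α) :
    ∃ C ⊆ U, IsCompact C ∧ ∃ ε > 0, ∀ x ∈ U \ C, ∀ t ∈ Icc (0 : ℝ) 1, ε < ‖H (x, t) - α t‖ := by
  set X : Set (Euc k × ℝ) := closure U ×ˢ Icc (0 : ℝ) 1 with hX
  -- The path is thickened by 1 so that, once `ε ≤ 1`, `T` contains every point of `X` where `H` is
  -- within `ε` of `α`.
  set K := Metric.cthickening 1 (α '' Icc 0 1) with hK
  have hKc : IsCompact K := (isCompact_Icc.image_of_continuousOn h.continuousOn_path).cthickening
  set T := X ∩ H ⁻¹' K with hT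
  have hTc : IsCompact T := h.properOn.isCompact_inter_preimage hKc
  let g : Euc k × ℝ → Euc k := fun p => H p - α p.2
  have hg : ContinuousOn g T := (h.continuousOn.mono inter_subset_left).sub
    (h.continuousOn_path.comp continuous_snd.continuousOn fun p hp => hp.1.2)
  have hfr : IsCompact (g '' (T ∩ (frontier U ×ˢ univ))) :=
    (hTc.inter_right (isClosed_frontier.prod isClosed_univ)).image_of_continuousOn
      (hg.mono inter_subset_left)
  have h0 : (g '' (T ∩ (frontier U ×ˢ univ)))ᶜ ∈ 𝓝 (0 : Euc k) := by
    refine hfr.isClosed.isOpen_compl.mem_nhds ?_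
    rintro ⟨p, ⟨hp, hpU, -⟩, hp0⟩
    exact h.ne_of_mem_frontier p.1 hpU p.2 hp.1.2 (sub_eq_zero.1 hp0)
  obtain ⟨δ, hδ, hball⟩ := Metric.mem_nhds_iff.1 h0
  -- The half fits the closed `ε`-ball into the open `δ`-ball; the bound 1 is the thickening radius
  -- of `K`.
  set ε := min (δ / 2) 1 with hε
  have hεδ : ε < δ := (min_le_left _ _).trans_lt (half_lt_self hδ)
  refine ⟨Prod.fst '' (T ∩ g ⁻¹' Metric.closedBall 0 ε), ?_, ?_, ε, by positivity, ?_⟩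
  · rintro _ ⟨p, ⟨hp, hpε⟩, rfl⟩
    by_contra hpU
    refine hball (a := g p) ?_ ⟨p, ⟨hp, ⟨hp.1.1, by rwa [h.isOpen.interior_eq]⟩, mem_univ _⟩, rfl⟩
    exact Metric.closedBall_subset_ball hεδ hpε
  · exact (hTc.of_isClosed_subset (hg.preimage_isClosed_of_isClosed hTc.isClosed
      Metric.isClosed_closedBall) inter_subset_left).image continuous_fst
  · rintro x ⟨hxU, hxC⟩ t ht
    by_contra! hle
    refine hxC ⟨(x, t), ⟨⟨⟨subset_closure hxU, ht⟩, ?_⟩, ?_⟩, rfl⟩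
    · refine Metric.mem_cthickening_of_dist_le _ (α t) 1 _ (mem_image_of_mem _ ht) ?_
      rw [dist_eq_norm]
      exact hle.trans (min_le_right _ _)
    · simpa [g] using hle

theorem deg_eq_of_homotopy {H : Euc k × ℝ → Euc k} {U : Set (Euc k)} {α : ℝ → Euc k}
    (hH : IsAdmissibleHomotopy H U α) (hs : IsSmoothHomotopy H U α)
    (h0 : IsRegularTriple (fun x => H (x, 0)) U (α 0))
    (h1 : IsRegularTriple (fun x => H (x, 1)) U (α 1)) :
    deg (fun x => H (x, 0)) U (α 0) = deg (fun x => H (x, 1)) U (α 1) := by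
  obtain ⟨C, hCU, hC, ε, hε, hfar⟩ := hH.exists_compact
  obtain ⟨ε₀, hε₀, hdeg0⟩ := h0.exists_setIntegral_eq_deg
  obtain ⟨ε₁, hε₁, hdeg1⟩ := h1.exists_setIntegral_eq_deg
  -- This radius makes the bump vanish at `H - α` off `C` and fits the localization radii at both
  -- ends.
  set r := min ε (min ε₀ ε₁) with hr
  have hr0 : 0 < r := by positivity
  let b : ContDiffBump (0 : Euc k) := ⟨r / 2, r, half_pos hr0, half_lt_self hr0⟩
  let φ : Euc k → ℝ := b.normed volume
  have hφs : Function.support φ = Metric.ball 0 r := b.support_normed_eq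
  have hφd : ContDiff ℝ ∞ φ := b.contDiff_normed
  have hφ1 : ∫ w, φ w = 1 := b.integral_normed
  have hφi : Integrable φ := b.integrable_normed
  have key : ∀ (t ρ : ℝ), r ≤ ρ →
      (∀ ψ : Euc k → ℝ, Integrable ψ → Function.support ψ ⊆ Metric.ball (α t) ρ →
        ∫ w, ψ w = 1 → ∫ x in U, ψ (H (x, t)) * (fderiv ℝ (fun x => H (x, t)) x).det =
          deg (fun x => H (x, t)) U (α t)) →
      ∫ x in U, φ (H (x, t) - α t) * (fderiv ℝ (fun x => H (x, t) - α t) x).det =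
        deg (fun x => H (x, t)) U (α t) := fun t ρ hρ hψ => by
    simp only [fderiv_sub_const]
    refine hψ (fun w => φ (w - α t)) (hφi.comp_sub_right _) (fun w hw => ?_) ?_
    · have hw' : w - α t ∈ Function.support φ := hw
      rw [hφs, mem_ball_zero_iff] at hw'
      rw [Metric.mem_ball, dist_eq_norm]
      exact hw'.trans_le hρ
    · rw [integral_sub_right_eq_self φ (α t), hφ1]
  have key0 := key 0 ε₀ ((min_le_right _ _).trans (min_le_left _ _)) hdeg0
  have key1 := key 1 ε₁ ((min_le_right _ _).trans (min_le_right _ _)) hdeg1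
  -- Hypotheses on `H` and `α` concern only times in `[0, 1]`, while `setIntegral_pullback_eq` uses
  -- all real times; the reparametrization `θ` maps `ℝ` smoothly into `[0, 1]` and fixes 0 and 1.
  let θ : ℝ → ℝ := Real.smoothTransition
  have hθ : ContDiff ℝ ∞ θ := Real.smoothTransition.contDiff
  have hθI : ∀ t, θ t ∈ Icc (0 : ℝ) 1 := fun t =>
    ⟨Real.smoothTransition.nonneg t, Real.smoothTransition.le_one t⟩
  have hθ0 : θ 0 = 0 := Real.smoothTransition.zero
  have hθ1 : θ 1 = 1 := Real.smoothTransition.one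
  have hG : ContDiffOn ℝ ∞ (fun p : Euc k × ℝ => H (p.1, θ p.2) - α (θ p.2)) (U ×ˢ univ) :=
    (hs.1.contDiffOn.comp (g := H) (f := fun p : Euc k × ℝ => (p.1, θ p.2))
      (contDiff_fst.prodMk (hθ.comp contDiff_snd)).contDiffOn
      fun p hp => ⟨subset_closure hp.1, hθI _⟩).sub
    (hs.2.contDiffOn.comp (g := α) (f := fun p : Euc k × ℝ => θ p.2)
      (hθ.comp contDiff_snd).contDiffOn fun p _ => hθI _)
  have h := setIntegral_pullback_eq hH.isOpen hC hCU hφd hG (fun x hx t => by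
    refine Function.notMem_support.1 fun hx' => ?_
    rw [hφs, mem_ball_zero_iff] at hx'
    exact lt_irrefl _ ((hfar x hx _ (hθI t)).trans (hx'.trans_le (min_le_left _ _))))
  simp only [hθ0, hθ1] at h
  rw [key0, key1] at h
  exact_mod_cast h

end BrouwerDegree

theorem mainTheorem1 (k : ℕ) :
    -- the degree of a regular triple is a genuine finite sum of indices
    (∀ (f : Euc k → Euc k) (U : Set (Euc k)) (y : Euc k), IsRegularTriple f U y →
      ∃ hfin : (f ⁻¹' {y} ∩ U).Finite, deg f U y = ∑ x ∈ hfin.toFinset, index f x) ∧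
    -- Normalization
    (IsRegularTriple (id : Euc k → Euc k) Set.univ 0 ∧
      deg (id : Euc k → Euc k) Set.univ 0 = 1) ∧
    -- Additivity
    (∀ (f : Euc k → Euc k) (U : Set (Euc k)) (y : Euc k), IsRegularTriple f U y →
      ∀ U₁ U₂ : Set (Euc k), IsOpen U₁ → IsOpen U₂ → U₁ ⊆ U → U₂ ⊆ U → Disjoint U₁ U₂ →
        f ⁻¹' {y} ∩ U ⊆ U₁ ∪ U₂ →
        IsRegularTriple f U₁ y ∧ IsRegularTriple f U₂ y ∧
          deg f U y = deg f U₁ y + deg f U₂ y) ∧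
    -- Homotopy Invariance
    (∀ (H : Euc k × ℝ → Euc k) (U : Set (Euc k)) (α : ℝ → Euc k),
      IsAdmissibleHomotopy H U α → IsSmoothHomotopy H U α →
      IsRegularTriple (fun x => H (x, 0)) U (α 0) →
      IsRegularTriple (fun x => H (x, 1)) U (α 1) →
        deg (fun x => H (x, 0)) U (α 0) = deg (fun x => H (x, 1)) U (α 1)) := by
  refine ⟨fun f U y h => ⟨h.finite, finsum_mem_eq_finite_toFinset_sum _ h.finite⟩,
    ⟨isRegularTriple_id, deg_id⟩, ?_, fun H U α hH hs h0 h1 => deg_eq_of_homotopy hH hs h0 h1⟩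
  intro f U y h U₁ U₂ hU₁ hU₂ h₁ h₂ hd hsub
  exact ⟨h.of_subset hU₁ hU₂ h₁ hd hsub,
    h.of_subset hU₂ hU₁ h₂ hd.symm (union_comm U₁ U₂ ▸ hsub), deg_eq_add h h₁ h₂ hd hsub⟩
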